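/- Let $\beta>1$. For real $t$ put $\langle t\rangle=1$ if $t\in\mathbb Z$ and $\langle t\rangle=t-\lfloor t\rfloor$ otherwise; for $x\in[0,1]$ let $\overline{T}_\beta(x)=\langle\beta x\rangle$, let $\overline{d}_\beta(x)=x_1x_2\cdots$ be the word with letters $x_i=\lceil\beta\,\overline{T}_\beta^{\,i-1}(x)\rceil-1$, and let $\mathrm{Diam}_\beta(x)=\sup_{n\ge0}\overline{T}_\beta^{\,n}(x)-\inf_{n\ge0}\overline{T}_\beta^{\,n}(x)$. The frequency of $x$ is the limit of $\frac1n\sum_{i=1}^n x_i$. A word $(w_n)_{n\ge0}$ is mechanical of slope $\alpha\ge0$ if for some $\rho\in[0,1]$ either $w_n=\lfloor\alpha(n+1)+\rho\rfloor-\lfloor\alpha n+\rho\rfloor$ for all $n$, or $w_n=\lceil\alpha(n+1)+\rho\rceil-\lceil\alpha n+\rho\rceil$ for all $n$; it is Sturmian of slope $\alpha$ if moreover $\alpha$ is irrational. A skew word of slope $r\in\mathbb Q$ is an infinite word over two consecutive integers $a$ and $b=a+1$ (both of which occur) that is balanced (the numbers of $b$ in any two factors of the same length differ by at most one), is not recurrent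 (some factor occurs only finitely often), and becomes a mechanical word of slope $r$ after removal of some nonempty prefix. There is exactly one real number, denoted $\mathrm{Freq}(\beta)$, that is the common frequency of all points of some orbit closure $K$ of $\overline{T}_\beta$ with $K\subset[1-\frac1\beta,1]$ and $\overline{T}_\beta(K)=K$. If $\xi\in[0,1]$ satisfies $\mathrm{Diam}_\beta(\xi)\le 1/\beta$, then exactly one of the following holds: (a) $\overline{d}_\beta(\xi)$ is a Sturmian word of slope at most $\mathrm{Freq}(\beta)$, and $\mathrm{Diam}_\beta(\xi)=1/\beta$; (b) for some rational $p/q\le\mathrm{Freq}(\beta)$ in lowest terms ($q\ge1$), $\overline{d}_\beta(\xi)$ is a mechanical word of slope $p/q$, and $\mathrm{Diam}_\beta(\xi)=\frac{\beta^{q-1}-1}{\beta^q-1}$; (c) for some rational $p/q\le\mathrm{Freq}(\beta)$ in lowest terms ($q\ge1$), $\overline{d}_\beta(\xi)$ is a skew word of slope $p/q$, and $\mathrm{Diam}_\beta(\overline{T}_\beta^{\,k}(\xi))=\frac{\beta^{q-1}-1}{\beta^q-1}$ for all sufficiently large $k$. -/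

import Mathlib

noncomputable section

/-! ### Infinite words over the integers -/

/-- The word `w` with its first `m` letters removed. -/
def shiftWord (m : ℕ) (w : ℕ → ℤ) : ℕ → ℤ := fun n => w (m + n)

/-- The lower mechanical word of slope `α` and intercept `ρ`. -/
def lowerMechanical (α ρ : ℝ) (n : ℕ) : ℤ := ⌊α * (n + 1) + ρ⌋ - ⌊α * n + ρ⌋

/-- The upper mechanical word of slope `α` and intercept `ρ`. -/
def upperMechanical (α ρ : ℝ) (n : ℕ) : ℤ := ⌈α * (n + 1) + ρ⌉ - ⌈α * n + ρ⌉

/-- `w` is a (lower or upper) mechanical word of slope `α`. -/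
def IsMechanical (w : ℕ → ℤ) (α : ℝ) : Prop :=
  0 ≤ α ∧ ∃ ρ ∈ Set.Icc (0 : ℝ) 1, w = lowerMechanical α ρ ∨ w = upperMechanical α ρ

/-- `w` is a Sturmian word of slope `α`: a mechanical word of irrational slope. -/
def IsSturmian (w : ℕ → ℤ) (α : ℝ) : Prop := Irrational α ∧ IsMechanical w α

/-- The number of occurrences of the letter `c` in the factor of `w` of length `n` that
starts at position `i`. -/
def factorCount (w : ℕ → ℤ) (c : ℤ) (i n : ℕ) : ℕ :=
  ((Finset.range n).filter fun k => w (i + k) = c).card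

/-- `w` is a balanced binary word, over two consecutive integers `a` and `b = a + 1`: two factors
of the same length have numbers of `b` that differ by at most one. -/
def IsBalanced (w : ℕ → ℤ) : Prop :=
  ∃ a b : ℤ, b = a + 1 ∧ Set.range w = {a, b} ∧
    ∀ n i j : ℕ, factorCount w b i n ≤ factorCount w b j n + 1

/-- `w` is recurrent: each of its factors occurs at arbitrarily late positions. -/
def IsRecurrent (w : ℕ → ℤ) : Prop :=
  ∀ i n N : ℕ, ∃ j, N ≤ j ∧ ∀ k < n, w (j + k) = w (i + k)

/-- `w` is a skew word of slope `r`: a balanced non-recurrent word which, after a nonempty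
prefix, is a mechanical word of rational slope `r`. -/
def IsSkew (w : ℕ → ℤ) (r : ℚ) : Prop :=
  IsBalanced w ∧ ¬ IsRecurrent w ∧ ∃ m : ℕ, 0 < m ∧ IsMechanical (shiftWord m w) (r : ℝ)

/-! ### The left-continuous beta-transformation and its expansions -/

/-- The fractional part of `t`, with the value `1` instead of `0` at integers. -/
def upperFract (t : ℝ) : ℝ := if Int.fract t = 0 then 1 else Int.fract t

/-- The transformation `x ↦ ⟨β x⟩` of `[0, 1]`. -/
def betaMap (β x : ℝ) : ℝ := upperFract (β * x)

/-- The expansion of `x`; the letter at position `n` is `⌈β Tⁿ(x)⌉ - 1`, with `T = betaMap β`. -/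
def betaExpansion (β x : ℝ) (n : ℕ) : ℤ := ⌈β * (betaMap β)^[n] x⌉ - 1

/-- The orbit of `x`, including `x`. -/
def betaOrbit (β x : ℝ) : Set ℝ := Set.range fun n : ℕ => (betaMap β)^[n] x

/-- The supremum of the orbit of `x` minus its infimum. -/
def betaDiam (β x : ℝ) : ℝ := (⨆ n : ℕ, (betaMap β)^[n] x) - ⨅ n : ℕ, (betaMap β)^[n] x

/-- The point `x` has frequency `α`: the average of the first `n` letters of its expansion
converges to `α`. -/
def HasFrequency (β x α : ℝ) : Prop :=
  Filter.Tendsto (fun n : ℕ => (∑ k ∈ Finset.range n, (betaExpansion β x k : ℝ)) / n)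
    Filter.atTop (nhds α)

/-- `α` is the frequency (common to all points) of an invariant orbit closure that is contained
in the interval `[1 - 1/β, 1]`. -/
def IsTopFrequency (β α : ℝ) : Prop :=
  ∃ x ∈ Set.Icc (0 : ℝ) 1,
    closure (betaOrbit β x) ⊆ Set.Icc (1 - 1 / β) 1 ∧
    betaMap β '' closure (betaOrbit β x) = closure (betaOrbit β x) ∧
    ∀ y ∈ closure (betaOrbit β x), HasFrequency β y α

/-- `Freq β` is the frequency of the invariant orbit closure contained in `[1 - 1/β, 1]`. -/
def Freq (β : ℝ) : ℝ := Classical.epsilon (IsTopFrequency β)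

/-! ### The three cases -/

def SturmianCase (β ξ : ℝ) : Prop :=
  (∃ α : ℝ, α ≤ Freq β ∧ IsSturmian (betaExpansion β ξ) α) ∧ betaDiam β ξ = 1 / β

/-- The rational slope is `r = p / q` in lowest terms, so that `q = r.den`. -/
def MechanicalCase (β ξ : ℝ) : Prop :=
  ∃ r : ℚ, (r : ℝ) ≤ Freq β ∧ IsMechanical (betaExpansion β ξ) (r : ℝ) ∧
    betaDiam β ξ = (β ^ (r.den - 1) - 1) / (β ^ r.den - 1)

/-- The rational slope is `r = p / q` in lowest terms, so that `q = r.den`. -/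
def SkewCase (β ξ : ℝ) : Prop :=
  ∃ r : ℚ, (r : ℝ) ≤ Freq β ∧ IsSkew (betaExpansion β ξ) r ∧
    ∃ K : ℕ, ∀ k : ℕ, K ≤ k →
      betaDiam β ((betaMap β)^[k] ξ) = (β ^ (r.den - 1) - 1) / (β ^ r.den - 1)

end

/-!
Let `S n` be the sum of the first `n` letters of a word and `d n = α * n - S n` its discrepancy.
Two orbits that stay within `1 / β` of each other have digit sums that differ by at most one: the
sign of their difference changes exactly when a carry `±1` occurs, and these carries alternate. So
the expansion of a point of diameter at most `1 / β` is balanced, hence has a slope `α`, and its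
discrepancy oscillates by at most `1`. An oscillation whose differences are all less than `1` means
that the word is mechanical; if the difference `1` is attained, then `α` is rational and the word
is skew.

Summation by parts makes a point a monotone function of the digit sums along its orbit. The
supremum `U α` and infimum `L α` of an orbit of mechanical digits of slope `α` are therefore the
values at `⌈α * n⌉` and `⌊α * n⌋`, and `U α - L α`, carried by the `n` with `α * n ∉ ℤ`, is the
diameter. The function `U` is strictly increasing and left-continuous, with right limit
`L α + 1 / β` at `α`. So exactly one `α` satisfies `U α ≤ 1 ≤ L α + 1 / β`, that is,
`1 - 1 / β ≤ L α` and `U α ≤ 1`, and this is `Freq β`.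
-/

section Words

open Filter Topology

/-! ### Factor sums and discrepancies -/

/-- The sum of the letters of the factor of `w` of length `n` that starts at position `i`. -/
def factorSum (w : ℕ → ℤ) (i n : ℕ) : ℤ := ∑ k ∈ Finset.range n, w (i + k)

/-- Factors of `w` of equal length have sums that differ by at most one. This is the form in which
the balance of a word is established; unlike `IsBalanced` it makes sense over any alphabet. -/
def SumBalanced (w : ℕ → ℤ) : Prop := ∀ n i j, factorSum w i n ≤ factorSum w j n + 1

/-- The averages of the prefixes of `w` converge to `α`. -/
def HasSlope (w : ℕ → ℤ) (α : ℝ) : Prop :=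
  Tendsto (fun n : ℕ => (factorSum w 0 n : ℝ) / n) atTop (𝓝 α)

/-- The amount by which the sum of the first `n` letters of `w` falls short of its expected value
`α * n`. Balanced and mechanical words are characterised by the oscillation of this sequence. -/
def discrepancy (w : ℕ → ℤ) (α : ℝ) (n : ℕ) : ℝ := α * n - factorSum w 0 n

variable {w : ℕ → ℤ} {α : ℝ}

@[simp] lemma factorSum_zero (w : ℕ → ℤ) (i : ℕ) : factorSum w i 0 = 0 := by simp [factorSum]

@[simp] lemma factorSum_one (w : ℕ → ℤ) (i : ℕ) : factorSum w i 1 = w i := by simp [factorSum]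

lemma factorSum_add (w : ℕ → ℤ) (i m n : ℕ) :
    factorSum w i (m + n) = factorSum w i m + factorSum w (i + m) n := by
  simp [factorSum, Finset.sum_range_add, add_assoc]

lemma factorSum_shiftWord (w : ℕ → ℤ) (m i n : ℕ) :
    factorSum (shiftWord m w) i n = factorSum w (m + i) n := by
  simp [factorSum, shiftWord, add_assoc]

lemma factorSum_neg (w : ℕ → ℤ) (i n : ℕ) : factorSum (-w) i n = -factorSum w i n := by
  simp [factorSum]

lemma factorSum_congr {i j n : ℕ} (h : ∀ k < n, w (i + k) = w (j + k)) :
    factorSum w i n = factorSum w j n :=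
  Finset.sum_congr rfl fun k hk => h k (Finset.mem_range.1 hk)

lemma factorSum_mul_le {n : ℕ} {c : ℤ} (h : ∀ i, factorSum w i n ≤ c) (i k : ℕ) :
    factorSum w i (k * n) ≤ k * c := by
  induction k with
  | zero => simp
  | succ k ih =>
    rw [Nat.succ_mul, factorSum_add]
    push_cast
    linarith [h (i + k * n)]

lemma le_factorSum_mul {n : ℕ} {c : ℤ} (h : ∀ i, c ≤ factorSum w i n) (i k : ℕ) :
    k * c ≤ factorSum w i (k * n) := by
  have := factorSum_mul_le (w := -w) (c := -c) (fun i => by simpa [factorSum_neg] using h i) i k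
  rw [factorSum_neg] at this
  linarith

@[simp] lemma discrepancy_zero (w : ℕ → ℤ) (α : ℝ) : discrepancy w α 0 = 0 := by
  simp [discrepancy]

lemma discrepancy_add (w : ℕ → ℤ) (α : ℝ) (i n : ℕ) :
    discrepancy w α (i + n) = discrepancy w α i + α * n - factorSum w i n := by
  simp only [discrepancy, factorSum_add, zero_add]
  push_cast
  ring

lemma discrepancy_shiftWord (w : ℕ → ℤ) (α : ℝ) (m n : ℕ) :
    discrepancy (shiftWord m w) α n = discrepancy w α (m + n) - discrepancy w α m := by
  rw [discrepancy_add, discrepancy, factorSum_shiftWord, add_zero]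
  ring

lemma discrepancy_neg (w : ℕ → ℤ) (α : ℝ) (n : ℕ) :
    discrepancy (-w) (-α) n = -discrepancy w α n := by
  simp only [discrepancy, factorSum_neg]
  push_cast
  ring

lemma SumBalanced.neg (hb : SumBalanced w) : SumBalanced (-w) := fun n i j => by
  simp only [factorSum_neg]
  linarith [hb n j i]

lemma HasSlope.unique {α' : ℝ} (h : HasSlope w α) (h' : HasSlope w α') : α = α' :=
  tendsto_nhds_unique h h'

lemma HasSlope.nonneg (h : HasSlope w α) (hw : ∀ n, 0 ≤ w n) : 0 ≤ α :=
  ge_of_tendsto' h fun n =>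
    div_nonneg (mod_cast Finset.sum_nonneg fun _ _ => hw _) n.cast_nonneg

lemma hasSlope_of_abs_discrepancy_le {C : ℝ} (h : ∀ n, |discrepancy w α n| ≤ C) :
    HasSlope w α := by
  have h0 : Tendsto (fun n : ℕ => discrepancy w α n * (n : ℝ)⁻¹) atTop (𝓝 0) :=
    bdd_le_mul_tendsto_zero' C (Eventually.of_forall h) tendsto_inv_atTop_nhds_zero_nat
  have h1 := h0.const_sub α
  rw [sub_zero] at h1
  refine h1.congr' ?_
  filter_upwards [eventually_ne_atTop 0] with n hn
  have hn' : (n : ℝ) ≠ 0 := mod_cast hn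
  rw [discrepancy]
  field_simp
  ring

lemma hasSlope_of_discrepancy_sub_le {C : ℝ}
    (h : ∀ i j, discrepancy w α i - discrepancy w α j ≤ C) : HasSlope w α :=
  hasSlope_of_abs_discrepancy_le (C := C) fun n => by
    have h1 := h n 0
    have h2 := h 0 n
    rw [discrepancy_zero] at h1 h2
    exact abs_le.2 ⟨by linarith, by linarith⟩

lemma hasSlope_of_shiftWord {m : ℕ} (h : HasSlope (shiftWord m w) α) : HasSlope w α := by
  refine (tendsto_add_atTop_iff_nat m).1 ?_
  have h1 : Tendsto (fun n : ℕ => (factorSum w 0 m : ℝ) / (n + m : ℕ)) atTop (𝓝 0) :=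
    tendsto_const_nhds.div_atTop
      (tendsto_natCast_atTop_atTop.comp (tendsto_add_atTop_nat m))
  have h2 := h1.add (h.mul (tendsto_natCast_div_add_atTop (𝕜 := ℝ) m))
  rw [zero_add, mul_one] at h2
  refine h2.congr' ?_
  filter_upwards [eventually_ne_atTop 0] with n hn
  have hn' : (n : ℝ) ≠ 0 := mod_cast hn
  rw [add_comm n m, factorSum_add, factorSum_shiftWord, add_zero, zero_add]
  push_cast
  field_simp
  ring

/-! ### Balanced words have a slope -/

lemma SumBalanced.mul_factorSum_sub_one_le (hb : SumBalanced w) (i j m n : ℕ) :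
    m * (factorSum w i n - 1) ≤ n * (factorSum w j m + 1) :=
  calc m * (factorSum w i n - 1) ≤ factorSum w 0 (m * n) :=
        le_factorSum_mul (fun k => by linarith [hb n i k]) 0 m
    _ = factorSum w 0 (n * m) := by rw [mul_comm]
    _ ≤ n * (factorSum w j m + 1) := factorSum_mul_le (fun k => hb m k j) 0 n

lemma SumBalanced.exists_discrepancy_sub_le (hb : SumBalanced w) :
    ∃ α, ∀ i j, discrepancy w α i - discrepancy w α j ≤ 1 := by
  obtain ⟨α, hlower, hupper⟩ := exists_between_of_forall_le
    (s := Set.range fun p : ℕ × ℕ => ((factorSum w p.1 (p.2 + 1) - 1 : ℝ)) / (p.2 + 1))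
    (t := Set.range fun p : ℕ × ℕ => ((factorSum w p.1 (p.2 + 1) + 1 : ℝ)) / (p.2 + 1))
    (Set.range_nonempty _) (Set.range_nonempty _) (by
      rintro _ ⟨⟨i, n⟩, rfl⟩ _ ⟨⟨j, m⟩, rfl⟩
      rw [div_le_div_iff₀ (by positivity) (by positivity)]
      have := hb.mul_factorSum_sub_one_le i j (m + 1) (n + 1)
      rify at this
      linarith)
  have hle (i n : ℕ) : |α * n - factorSum w i n| ≤ 1 := by
    rcases n with _ | n
    · simp
    have h1 := hlower ⟨(i, n), rfl⟩
    have h2 := hupper ⟨(i, n), rfl⟩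
    rw [div_le_iff₀ (by positivity)] at h1
    rw [le_div_iff₀ (by positivity)] at h2
    push_cast
    exact abs_le.2 ⟨by linarith, by linarith⟩
  refine ⟨α, fun i j => ?_⟩
  rcases le_total i j with h | h
  · obtain ⟨n, rfl⟩ := Nat.exists_eq_add_of_le h
    rw [discrepancy_add]
    linarith [(abs_le.1 (hle i n)).1]
  · obtain ⟨n, rfl⟩ := Nat.exists_eq_add_of_le h
    rw [discrepancy_add]
    linarith [(abs_le.1 (hle j n)).2]

lemma SumBalanced.discrepancy_sub_le (hb : SumBalanced w) (hα : HasSlope w α) (i j : ℕ) :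
    discrepancy w α i - discrepancy w α j ≤ 1 := by
  obtain ⟨α', h⟩ := hb.exists_discrepancy_sub_le
  rw [hα.unique (hasSlope_of_discrepancy_sub_le h)]
  exact h i j

/-! ### Mechanical words -/

lemma factorSum_lowerMechanical (α ρ : ℝ) (n : ℕ) :
    factorSum (lowerMechanical α ρ) 0 n = ⌊α * n + ρ⌋ - ⌊ρ⌋ := by
  have := Finset.sum_range_sub (fun k : ℕ => ⌊α * k + ρ⌋) n
  simpa [factorSum, lowerMechanical] using this

lemma factorSum_upperMechanical (α ρ : ℝ) (n : ℕ) :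
    factorSum (upperMechanical α ρ) 0 n = ⌈α * n + ρ⌉ - ⌈ρ⌉ := by
  have := Finset.sum_range_sub (fun k : ℕ => ⌈α * k + ρ⌉) n
  simpa [factorSum, upperMechanical] using this

lemma IsMechanical.discrepancy_sub_lt (h : IsMechanical w α) (i j : ℕ) :
    discrepancy w α i - discrepancy w α j < 1 := by
  obtain ⟨-, ρ, -, rfl | rfl⟩ := h
  · have hd (n : ℕ) : discrepancy (lowerMechanical α ρ) α n
        = Int.fract (α * n + ρ) - Int.fract ρ := by
      rw [discrepancy, factorSum_lowerMechanical, Int.fract, Int.fract]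
      push_cast
      ring
    rw [hd, hd]
    linarith [Int.fract_lt_one (α * i + ρ), Int.fract_nonneg (α * j + ρ)]
  · have hd (n : ℕ) : discrepancy (upperMechanical α ρ) α n
        = Int.fract (-ρ) - Int.fract (-(α * n + ρ)) := by
      rw [discrepancy, factorSum_upperMechanical, Int.fract, Int.fract, Int.floor_neg,
        Int.floor_neg]
      push_cast
      ring
    rw [hd, hd]
    linarith [Int.fract_lt_one (-(α * j + ρ)), Int.fract_nonneg (-(α * i + ρ))]

lemma eq_lowerMechanical {ρ : ℝ} (h : ∀ n, discrepancy w α n + ρ ∈ Set.Ico 0 1) :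
    w = lowerMechanical α ρ := by
  have hfloor (n : ℕ) : ⌊α * n + ρ⌋ = factorSum w 0 n := by
    obtain ⟨h1, h2⟩ := h n
    rw [discrepancy] at h1 h2
    exact Int.floor_eq_iff.2 ⟨by linarith, by linarith⟩
  funext n
  have := hfloor (n + 1)
  push_cast at this
  simp [lowerMechanical, this, hfloor, factorSum_add]

lemma eq_upperMechanical {ρ : ℝ} (h : ∀ n, discrepancy w α n + ρ ∈ Set.Ioc 0 1) :
    w = upperMechanical α ρ := by
  have hceil (n : ℕ) : ⌈α * n + ρ⌉ = factorSum w 0 n + 1 := by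
    obtain ⟨h1, h2⟩ := h n
    rw [discrepancy] at h1 h2
    exact Int.ceil_eq_iff.2 ⟨by push_cast; linarith, by push_cast; linarith⟩
  funext n
  have := hceil (n + 1)
  push_cast at this
  simp [upperMechanical, this, hceil, factorSum_add]

lemma isMechanical_of_discrepancy_sub_lt (h0 : 0 ≤ α)
    (hd : ∀ i j, discrepancy w α i - discrepancy w α j < 1) : IsMechanical w α := by
  by_cases hmin : ∃ m, ∀ n, discrepancy w α m ≤ discrepancy w α n
  · obtain ⟨m, hm⟩ := hmin
    have hm0 := hm 0
    have h0m := hd 0 m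
    rw [discrepancy_zero] at hm0 h0m
    refine ⟨h0, -discrepancy w α m, ⟨by linarith, by linarith⟩, .inl (eq_lowerMechanical ?_)⟩
    exact fun n => ⟨by linarith [hm n], by linarith [hd n m]⟩
  · push Not at hmin
    have hbdd : BddBelow (Set.range (discrepancy w α)) := ⟨discrepancy w α 0 - 1, by
      rintro _ ⟨n, rfl⟩
      linarith [hd 0 n]⟩
    have hpos (n : ℕ) : ⨅ k, discrepancy w α k < discrepancy w α n :=
      (hmin n).elim fun m hm => (ciInf_le hbdd m).trans_lt hm
    have hle (n : ℕ) : discrepancy w α n - 1 ≤ ⨅ k, discrepancy w α k :=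
      le_ciInf fun k => by linarith [hd n k]
    have hpos0 := hpos 0
    have hle0 := hle 0
    rw [discrepancy_zero] at hpos0 hle0
    refine ⟨h0, -⨅ k, discrepancy w α k, ⟨by linarith, by linarith⟩,
      .inr (eq_upperMechanical ?_)⟩
    exact fun n => ⟨by linarith [hpos n], by linarith [hle n]⟩

lemma isMechanical_iff :
    IsMechanical w α ↔ 0 ≤ α ∧ ∀ i j, discrepancy w α i - discrepancy w α j < 1 :=
  ⟨fun h => ⟨h.1, h.discrepancy_sub_lt⟩, fun h => isMechanical_of_discrepancy_sub_lt h.1 h.2⟩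

lemma IsMechanical.hasSlope (h : IsMechanical w α) : HasSlope w α :=
  hasSlope_of_discrepancy_sub_le fun i j => (h.discrepancy_sub_lt i j).le

lemma IsMechanical.shiftWord (h : IsMechanical w α) (m : ℕ) :
    IsMechanical (shiftWord m w) α := by
  refine isMechanical_iff.2 ⟨h.1, fun i j => ?_⟩
  rw [discrepancy_shiftWord, discrepancy_shiftWord]
  linarith [h.discrepancy_sub_lt (m + i) (m + j)]

lemma factorSum_le_ceil (hd : ∀ i j, discrepancy w α i - discrepancy w α j < 1) (i n : ℕ) :
    factorSum w i n ≤ ⌈α * n⌉ := by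
  have h := hd i (i + n)
  rw [discrepancy_add] at h
  rw [Int.le_ceil_iff]
  linarith

lemma floor_le_factorSum (hd : ∀ i j, discrepancy w α i - discrepancy w α j < 1) (i n : ℕ) :
    ⌊α * n⌋ ≤ factorSum w i n := by
  have h := hd (i + n) i
  rw [discrepancy_add] at h
  rw [Int.floor_le_iff]
  linarith

lemma IsMechanical.abs_le_ceil (h : IsMechanical w α) (n : ℕ) : |w n| ≤ ⌈α⌉ := by
  have h1 := factorSum_le_ceil h.discrepancy_sub_lt n 1
  have h2 := floor_le_factorSum h.discrepancy_sub_lt n 1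
  rw [factorSum_one, Nat.cast_one, mul_one] at h1 h2
  rwa [abs_of_nonneg ((Int.floor_nonneg.2 h.1).trans h2)]

lemma IsMechanical.discrepancy_add_den {r : ℚ} (h : IsMechanical w r) (n : ℕ) :
    discrepancy w r (n + r.den) = discrepancy w r n := by
  have hr : (r : ℝ) * r.den = r.num := mod_cast r.mul_den_eq_num
  have hint : discrepancy w r (n + r.den) - discrepancy w r n
      = (r.num - factorSum w n r.den : ℤ) := by
    rw [discrepancy_add, hr]
    push_cast
    ring
  have habs : |(r.num - factorSum w n r.den : ℤ)| < 1 := by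
    rify
    have := hint.symm
    push_cast at this
    rw [this, abs_lt]
    exact ⟨by linarith [h.discrepancy_sub_lt n (n + r.den)], h.discrepancy_sub_lt _ _⟩
  rw [Int.abs_lt_one_iff.1 habs, Int.cast_zero] at hint
  linarith

lemma IsMechanical.periodic {r : ℚ} (h : IsMechanical w r) : Function.Periodic w r.den := by
  intro n
  have h1 := h.discrepancy_add_den (n + 1)
  rw [add_right_comm, discrepancy_add _ _ (n + r.den), h.discrepancy_add_den,
    discrepancy_add _ _ n, factorSum_one, factorSum_one] at h1
  exact mod_cast (by linarith : (w (n + r.den) : ℝ) = w n)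

lemma isRecurrent_of_periodic {q : ℕ} (hq : 0 < q) (h : Function.Periodic w q) :
    IsRecurrent w := fun i n N => by
  refine ⟨i + N * q, by nlinarith, fun k _ => ?_⟩
  rw [show i + N * q + k = i + k + N * q by ring]
  exact h.nat_mul N (i + k)

/-! ### Skew words -/

lemma IsSkew.hasSlope {r : ℚ} (h : IsSkew w r) : HasSlope w r := by
  obtain ⟨-, -, m, -, hm⟩ := h
  exact hasSlope_of_shiftWord hm.hasSlope

lemma IsMechanical.not_isSkew {r s : ℚ} (h : IsMechanical w r) : ¬ IsSkew w s :=
  fun hs => hs.2.1 (isRecurrent_of_periodic r.den_pos h.periodic)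

lemma IsSturmian.not_hasSlope_ratCast (h : IsSturmian w α) (r : ℚ) : ¬ HasSlope w r :=
  fun hr => h.1 ⟨r, hr.unique h.2.hasSlope⟩

lemma isRecurrent_neg : IsRecurrent (-w) ↔ IsRecurrent w := by simp [IsRecurrent]

lemma SumBalanced.abs_sub_le_one (hb : SumBalanced w) (i j : ℕ) : |w i - w j| ≤ 1 := by
  have h1 := hb 1 i j
  have h2 := hb 1 j i
  rw [factorSum_one, factorSum_one] at h1 h2
  exact abs_le.2 ⟨by linarith, by linarith⟩

lemma factorSum_eq_mul_add_factorCount {a : ℤ} (hw : ∀ k, w k = a ∨ w k = a + 1) (i n : ℕ) :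
    factorSum w i n = n * a + factorCount w (a + 1) i n := by
  rw [factorSum, factorCount, Finset.card_filter]
  push_cast
  rw [← nsmul_eq_mul, ← Finset.card_range n, ← Finset.sum_const, Finset.card_range,
    ← Finset.sum_add_distrib]
  refine Finset.sum_congr rfl fun k _ => ?_
  rcases hw (i + k) with h | h <;> simp [h]

lemma SumBalanced.isBalanced (hb : SumBalanced w) {i j : ℕ} (hij : w i < w j) :
    IsBalanced w := by
  have hj : w j = w i + 1 := by have := abs_le.1 (hb.abs_sub_le_one j i); omega
  have hw (k : ℕ) : w k = w i ∨ w k = w i + 1 := by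
    have := abs_le.1 (hb.abs_sub_le_one k i)
    have := abs_le.1 (hb.abs_sub_le_one j k)
    omega
  refine ⟨w i, w i + 1, rfl, ?_, fun n l m => ?_⟩
  · refine Set.Subset.antisymm (Set.range_subset_iff.2 hw) ?_
    rintro _ (rfl | rfl)
    exacts [⟨i, rfl⟩, ⟨j, hj⟩]
  · have := hb n l m
    rw [factorSum_eq_mul_add_factorCount hw, factorSum_eq_mul_add_factorCount hw] at this
    omega

lemma exists_lt_of_not_isRecurrent (hr : ¬ IsRecurrent w) : ∃ i j, w i < w j := by
  by_contra! h
  exact hr fun i n N => ⟨N, le_rfl, fun k _ => le_antisymm (h _ _) (h _ _)⟩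

lemma exists_eq_ratCast_of_discrepancy_eq_one {n m : ℕ}
    (h : discrepancy w α m - discrepancy w α n = 1) : ∃ r : ℚ, α = r := by
  have hmn : m ≠ n := by
    rintro rfl
    norm_num at h
  have hne : (m : ℝ) - n ≠ 0 := sub_ne_zero.2 (mod_cast hmn)
  refine ⟨(factorSum w 0 m - factorSum w 0 n + 1) / ((m : ℚ) - n), ?_⟩
  rw [discrepancy, discrepancy] at h
  push_cast
  rw [eq_div_iff hne]
  linarith

/-- An ascent of the discrepancy by its full oscillation cannot be undone: by balance a return to
the minimum after `b` further steps would repeat with period `b`, the ascent would repeat with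
its own period `m - n`, and the two progressions would meet. -/
lemma SumBalanced.discrepancy_ne (hb : SumBalanced w)
    (hd : ∀ i j, discrepancy w α i - discrepancy w α j ≤ 1) {n m k : ℕ} (hnm : n < m)
    (h : discrepancy w α m - discrepancy w α n = 1) (hk : m ≤ k) :
    discrepancy w α k ≠ discrepancy w α n := by
  intro hkn
  have hincr (l i j : ℕ) : discrepancy w α (i + l) - discrepancy w α i
      ≤ discrepancy w α (j + l) - discrepancy w α j + 1 := by
    have : (factorSum w j l : ℝ) ≤ factorSum w i l + 1 := mod_cast hb l j i
    rw [discrepancy_add, discrepancy_add]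
    linarith
  obtain ⟨a, rfl⟩ := Nat.exists_eq_add_of_le hnm.le
  obtain ⟨b, rfl⟩ := Nat.exists_eq_add_of_le hk
  have hlow (t : ℕ) : discrepancy w α (n + t * b) = discrepancy w α n := by
    induction t with
    | zero => simp
    | succ t ih =>
      have h1 := hincr b (n + t * b) (n + a)
      have h2 := hd (n + a) (n + (t + 1) * b)
      rw [add_assoc n, ← Nat.succ_mul] at h1
      linarith
  have hhigh (t : ℕ) : discrepancy w α (n + (t + 1) * a) = discrepancy w α (n + a) := by
    induction t with
    | zero => simp
    | succ t ih =>
      have h1 := hincr a n (n + (t + 1) * a)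
      have h2 := hd (n + (t + 1 + 1) * a) n
      rw [add_assoc n _ a, ← Nat.succ_mul] at h1
      linarith
  rcases b with _ | b
  · rw [add_zero] at hkn
    linarith
  · have h1 := hhigh b
    rw [mul_comm, hlow] at h1
    linarith

lemma SumBalanced.not_isRecurrent_and_tail_discrepancy_sub_lt (hb : SumBalanced w)
    (hd : ∀ i j, discrepancy w α i - discrepancy w α j ≤ 1) {n m : ℕ} (hnm : n < m)
    (h : discrepancy w α m - discrepancy w α n = 1) :
    ¬ IsRecurrent w ∧
      ∀ i j, m ≤ i → m ≤ j → discrepancy w α i - discrepancy w α j < 1 := by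
  refine ⟨fun hrec => ?_, fun i j _ hj => ?_⟩
  · obtain ⟨j, hj, hw⟩ := hrec n (m - n) m
    refine hb.discrepancy_ne hd hnm h hj ?_
    have h1 := discrepancy_add w α j (m - n)
    have h2 := discrepancy_add w α n (m - n)
    rw [Nat.add_sub_cancel' hnm.le, ← factorSum_congr hw] at h2
    linarith [hd (j + (m - n)) n, hd m j]
  · refine lt_of_le_of_ne (hd i j) fun hij => hb.discrepancy_ne hd hnm h hj ?_
    linarith [hd i n, hd m j]

lemma SumBalanced.not_isRecurrent_and_exists_tail_discrepancy_sub_lt (hb : SumBalanced w)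
    (hd : ∀ i j, discrepancy w α i - discrepancy w α j ≤ 1) {n m : ℕ}
    (h : discrepancy w α m - discrepancy w α n = 1) :
    ¬ IsRecurrent w ∧
      ∃ p > 0, ∀ i j, p ≤ i → p ≤ j → discrepancy w α i - discrepancy w α j < 1 := by
  rcases lt_trichotomy n m with hnm | rfl | hmn
  · have := hb.not_isRecurrent_and_tail_discrepancy_sub_lt hd hnm h
    exact ⟨this.1, m, by omega, this.2⟩
  · norm_num at h
  · have := hb.neg.not_isRecurrent_and_tail_discrepancy_sub_lt (α := -α) (fun i j => by
      simp only [discrepancy_neg]; linarith [hd j i]) hmn (by simp only [discrepancy_neg]; linarith)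
    rw [isRecurrent_neg] at this
    refine ⟨this.1, n, by omega, fun i j hi hj => ?_⟩
    have h1 := this.2 j i hj hi
    rw [discrepancy_neg, discrepancy_neg] at h1
    linarith

theorem SumBalanced.isMechanical_or_isSkew (hb : SumBalanced w) (h0 : 0 ≤ α)
    (hα : HasSlope w α) : IsMechanical w α ∨ ∃ r : ℚ, α = r ∧ IsSkew w r := by
  have hd := hb.discrepancy_sub_le hα
  by_cases hstrict : ∀ i j, discrepancy w α i - discrepancy w α j < 1
  · exact .inl (isMechanical_of_discrepancy_sub_lt h0 hstrict)
  push Not at hstrict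
  obtain ⟨m, n, hmn⟩ := hstrict
  have h1 := le_antisymm (hd m n) hmn
  obtain ⟨r, rfl⟩ := exists_eq_ratCast_of_discrepancy_eq_one h1
  obtain ⟨hrec, p, hp, htail⟩ := hb.not_isRecurrent_and_exists_tail_discrepancy_sub_lt hd h1
  obtain ⟨i, j, hij⟩ := exists_lt_of_not_isRecurrent hrec
  refine .inr ⟨r, rfl, hb.isBalanced hij, hrec, p, hp, isMechanical_iff.2 ⟨h0, fun i j => ?_⟩⟩
  rw [discrepancy_shiftWord, discrepancy_shiftWord]
  linarith [htail (p + i) (p + j) (by omega) (by omega)]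

lemma exists_seq_ceil_le_factorSum (hd : BddAbove (Set.range (discrepancy w α))) :
    ∃ u : ℕ → ℕ, ∀ n : ℕ, ∀ᶠ k in atTop, ⌈α * n⌉ ≤ factorSum w (u k) n := by
  obtain ⟨v, -, hv, hmem⟩ := exists_seq_tendsto_sSup (Set.range_nonempty _) hd
  choose u hu using hmem
  refine ⟨u, fun n => ?_⟩
  have hlt : sSup (Set.range (discrepancy w α)) - (α * n - (⌈α * n⌉ - 1))
      < sSup (Set.range (discrepancy w α)) := by
    linarith [Int.ceil_lt_add_one (α * n)]
  filter_upwards [hv.eventually_const_lt hlt] with k hk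
  have hsup := le_csSup hd ⟨u k + n, rfl⟩
  rw [discrepancy_add, hu] at hsup
  rw [← Int.sub_one_lt_iff]
  rify
  linarith

end Words

section Orbits

open Filter Topology

/-! ### Sequences expanded in base `β` -/

/-- `x` is a bounded sequence such that passing from `x n` to `x (n + 1)` multiplies by `β` and
removes the digit `w n`. Unlike an orbit of `betaMap` it is not confined to the unit interval, so
that differences of orbits are covered as well. -/
structure IsBetaOrbit (β : ℝ) (x : ℕ → ℝ) (w : ℕ → ℤ) : Prop where
  bounded : ∃ M, ∀ n, |x n| ≤ M
  step : ∀ n, β * x n = w n + x (n + 1)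

namespace IsBetaOrbit

variable {β : ℝ} {x x' : ℕ → ℝ} {w w' : ℕ → ℤ}

lemma shift (h : IsBetaOrbit β x w) (m : ℕ) :
    IsBetaOrbit β (fun n => x (m + n)) (shiftWord m w) where
  bounded := h.bounded.imp fun _ hM _ => hM _
  step _ := h.step _

lemma neg (h : IsBetaOrbit β x w) : IsBetaOrbit β (-x) (-w) where
  bounded := h.bounded.imp fun M hM n => by simpa using hM n
  step n := by simp [h.step n, add_comm]

lemma sub (h : IsBetaOrbit β x w) (h' : IsBetaOrbit β x' w') :
    IsBetaOrbit β (x - x') (w - w') where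
  bounded := by
    obtain ⟨M, hM⟩ := h.bounded
    obtain ⟨M', hM'⟩ := h'.bounded
    exact ⟨M + M', fun n => (abs_sub _ _).trans (add_le_add (hM n) (hM' n))⟩
  step n := by
    simp only [Pi.sub_apply, mul_sub, h.step n, h'.step n]
    push_cast
    ring

lemma unique (h : IsBetaOrbit β x w) (h' : IsBetaOrbit β x' w) (hβ : 1 < β) : x = x' := by
  have hβ0 : 0 < β := by linarith
  obtain ⟨M, hM⟩ := (h.sub h').bounded
  have hle (k n : ℕ) : |(x - x') n| ≤ M * β⁻¹ ^ k := by
    induction k generalizing n with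
    | zero => simpa using hM n
    | succ k ih =>
      have hstep : (x - x') n = β⁻¹ * (x - x') (n + 1) := by
        rw [eq_inv_mul_iff_mul_eq₀ hβ0.ne']
        simpa using (h.sub h').step n
      rw [hstep, abs_mul, abs_of_pos (inv_pos.2 hβ0), pow_succ, ← mul_assoc, mul_comm]
      exact mul_le_mul_of_nonneg_right (ih (n + 1)) (inv_pos.2 hβ0).le
  have hlim : Tendsto (fun k : ℕ => M * β⁻¹ ^ k) atTop (𝓝 0) := by
    simpa using (tendsto_pow_atTop_nhds_zero_of_lt_one (inv_pos.2 hβ0).le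
      (inv_lt_one_of_one_lt₀ hβ)).const_mul M
  funext n
  have := ge_of_tendsto' hlim fun k => hle k n
  exact sub_eq_zero.1 (abs_nonpos_iff.1 this)

lemma exists_abs_digit_le (h : IsBetaOrbit β x w) : ∃ C : ℝ, ∀ n, |(w n : ℝ)| ≤ C := by
  obtain ⟨M, hM⟩ := h.bounded
  refine ⟨|β| * M + M, fun n => ?_⟩
  rw [eq_sub_of_add_eq (h.step n).symm]
  refine (abs_sub _ _).trans (add_le_add ?_ (hM _))
  rw [abs_mul]
  exact mul_le_mul_of_nonneg_left (hM n) (abs_nonneg β)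

/-! ### Carries -/

lemma carry_step (hβ : 1 < β) {s t : ℝ} {a : ℤ} (hstep : β * s = a + t) (hs0 : 0 ≤ s)
    (hs : s ≤ β⁻¹) (ht : |t| ≤ β⁻¹) : (a = 0 ∧ 0 ≤ t) ∨ (a = 1 ∧ t ≤ 0) := by
  have hβ0 : 0 < β := by linarith
  have hc : β⁻¹ < 1 := inv_lt_one_of_one_lt₀ hβ
  have h0 : 0 ≤ β * s := mul_nonneg hβ0.le hs0
  have h1 : β * s ≤ 1 := by simpa [hβ0.ne'] using mul_le_mul_of_nonneg_left hs hβ0.le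
  obtain ⟨ht1, ht2⟩ := abs_le.1 ht
  have ha1 : -1 < a := by rify; linarith
  have ha2 : a < 2 := by rify; linarith
  obtain rfl | rfl : a = 0 ∨ a = 1 := by omega
  · exact .inl ⟨rfl, by push_cast at hstep; linarith⟩
  · exact .inr ⟨rfl, by push_cast at hstep; linarith⟩

lemma factorSum_carry (h : IsBetaOrbit β x w) (hβ : 1 < β) (hx : ∀ n, |x n| ≤ β⁻¹)
    (h0 : 0 ≤ x 0) (n : ℕ) :
    (factorSum w 0 n = 0 ∧ 0 ≤ x n) ∨ (factorSum w 0 n = 1 ∧ x n ≤ 0) := by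
  induction n with
  | zero => exact .inl ⟨factorSum_zero w 0, h0⟩
  | succ n ih =>
    rw [factorSum_add, factorSum_one, zero_add]
    rcases ih with ⟨hF, hn⟩ | ⟨hF, hn⟩ <;> rw [hF]
    · rcases carry_step hβ (h.step n) hn (abs_le.1 (hx n)).2 (hx _) with ⟨hw, ht⟩ | ⟨hw, ht⟩
      · exact .inl ⟨by rw [hw, add_zero], ht⟩
      · exact .inr ⟨by rw [hw, zero_add], ht⟩
    · have hstep : β * -x n = (-w n : ℤ) + -x (n + 1) := by
        push_cast
        linarith [h.step n]
      rcases carry_step hβ hstep (neg_nonneg.2 hn) (neg_le.1 (abs_le.1 (hx n)).1)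
        (by rw [abs_neg]; exact hx _) with ⟨hw, ht⟩ | ⟨hw, ht⟩
      · exact .inr ⟨by omega, neg_nonneg.1 ht⟩
      · exact .inl ⟨by omega, neg_nonpos.1 ht⟩

lemma abs_factorSum_le_one (h : IsBetaOrbit β x w) (hβ : 1 < β) (hx : ∀ n, |x n| ≤ β⁻¹)
    (n : ℕ) : |factorSum w 0 n| ≤ 1 := by
  rcases le_total 0 (x 0) with h0 | h0
  · rcases h.factorSum_carry hβ hx h0 n with ⟨hF, -⟩ | ⟨hF, -⟩ <;> simp [hF]
  · rcases h.neg.factorSum_carry hβ (by simpa using hx) (by simpa using h0) n with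
      ⟨hF, -⟩ | ⟨hF, -⟩ <;> rw [← abs_neg, ← factorSum_neg, hF] <;> simp

lemma sumBalanced (h : IsBetaOrbit β x w) (hβ : 1 < β) (hx : ∀ i j, |x i - x j| ≤ β⁻¹) :
    SumBalanced w := fun n i j => by
  have := ((h.shift i).sub (h.shift j)).abs_factorSum_le_one hβ (fun n => hx _ _) n
  have hF : factorSum (shiftWord i w - shiftWord j w) 0 n = factorSum w i n - factorSum w j n := by
    simp [factorSum, shiftWord]
  rw [hF] at this
  linarith [(abs_le.1 this).2]

end IsBetaOrbit

/-! ### Abel summation of digit sequences -/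

/-- The number whose digits in base `β` have partial sums `f`; it is obtained from the series of
the digits by summation by parts, and is monotone in `f`. -/
noncomputable def betaValue (β : ℝ) (f : ℕ → ℝ) : ℝ := (1 - β⁻¹) * ∑' n, f n * β⁻¹ ^ n

/-- The sequence `f` grows at most linearly, with constant `C`. -/
def LinearGrowthWith (C : ℝ) (f : ℕ → ℝ) : Prop := ∀ n : ℕ, |f n| ≤ C * (n + 1)

namespace LinearGrowthWith

variable {C D : ℝ} {f g : ℕ → ℝ}

lemma mono (hf : LinearGrowthWith C f) (h : C ≤ D) : LinearGrowthWith D f := fun n =>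
  (hf n).trans (mul_le_mul_of_nonneg_right h (by positivity))

lemma min (hf : LinearGrowthWith C f) (hg : LinearGrowthWith D g) :
    LinearGrowthWith (max C D) fun n => min (f n) (g n) := fun n =>
  abs_min_le_max_abs_abs.trans
    (max_le (hf.mono (le_max_left C D) n) (hg.mono (le_max_right C D) n))

lemma const_mul (hf : LinearGrowthWith C f) (a : ℝ) :
    LinearGrowthWith (|a| * C) fun n => a * f n := fun n => by
  rw [abs_mul, mul_assoc]
  exact mul_le_mul_of_nonneg_left (hf n) (abs_nonneg a)

lemma summable {β : ℝ} (hf : LinearGrowthWith C f) (hβ : 1 < β) :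
    Summable fun n => f n * β⁻¹ ^ n := by
  have hc0 : 0 < β⁻¹ := by positivity
  have hc : ‖β⁻¹‖ < 1 := by
    rw [Real.norm_of_nonneg hc0.le]
    exact inv_lt_one_of_one_lt₀ hβ
  have hbound : Summable fun n : ℕ => C * (n + 1) * β⁻¹ ^ n :=
    (((summable_pow_mul_geometric_of_norm_lt_one 1 hc).mul_left C).add
      ((summable_geometric_of_norm_lt_one hc).mul_left C)).congr fun n => by ring
  refine hbound.of_norm_bounded fun n => ?_
  rw [Real.norm_eq_abs, abs_mul, abs_of_pos (pow_pos hc0 n)]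
  exact mul_le_mul_of_nonneg_right (hf n) (pow_pos hc0 n).le

end LinearGrowthWith

section

variable {β C D : ℝ} {f g : ℕ → ℝ}

lemma linearGrowthWith_factorSum {w : ℕ → ℤ} (hw : ∀ n, |(w n : ℝ)| ≤ C) (i : ℕ) :
    LinearGrowthWith C fun n => factorSum w i n := fun n =>
  calc |(factorSum w i n : ℝ)| ≤ ∑ k ∈ Finset.range n, |(w (i + k) : ℝ)| := by
        rw [factorSum, Int.cast_sum]
        exact Finset.abs_sum_le_sum_abs _ _
    _ ≤ n • C := by simpa using Finset.sum_le_card_nsmul (Finset.range n) _ C fun k _ => hw _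
    _ ≤ C * (n + 1) := by
      rw [nsmul_eq_mul]
      linarith [(abs_nonneg _).trans (hw 0)]

lemma linearGrowthWith_ceil {α : ℝ} (hα : |α| ≤ C) :
    LinearGrowthWith (C + 1) fun n => ⌈α * n⌉ := fun n => by
  have h1 : |α * n| ≤ C * n := by
    rw [abs_mul, Nat.abs_cast]
    exact mul_le_mul_of_nonneg_right hα n.cast_nonneg
  have hC : 0 ≤ C := (abs_nonneg α).trans hα
  have hn : (0 : ℝ) ≤ n := n.cast_nonneg
  rw [abs_le] at h1 ⊢
  constructor <;> nlinarith [Int.le_ceil (α * n), Int.ceil_lt_add_one (α * n)]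

lemma linearGrowthWith_floor {α : ℝ} (hα : |α| ≤ C) :
    LinearGrowthWith (C + 1) fun n => ⌊α * n⌋ := fun n => by
  have h := linearGrowthWith_ceil (α := -α) (C := C) (by rwa [abs_neg]) n
  simpa only [neg_mul, Int.ceil_neg, Int.cast_neg, abs_neg] using h

lemma linearGrowthWith_mul_add_one (C : ℝ) :
    LinearGrowthWith |C| fun n => C * (n + 1) := fun n => by
  rw [abs_mul, abs_of_pos (n.cast_add_one_pos : (0 : ℝ) < n + 1)]

lemma linearGrowthWith_indicator (p : ℕ → Prop) [DecidablePred p] :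
    LinearGrowthWith 1 fun n => if p n then 1 else 0 := fun n => by
  beta_reduce
  split_ifs
  · simp
  · simp only [abs_zero]
    positivity

lemma linearGrowthWith_const (hf : |D| ≤ C) : LinearGrowthWith C fun _ => D := fun n => by
  nlinarith [abs_nonneg D, (n.cast_nonneg : (0 : ℝ) ≤ n)]

lemma betaValue_neg (β : ℝ) (f : ℕ → ℝ) : betaValue β (fun n => -f n) = -betaValue β f := by
  simp [betaValue, tsum_neg]

lemma betaValue_const_mul (β a : ℝ) (f : ℕ → ℝ) :
    betaValue β (fun n => a * f n) = a * betaValue β f := by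
  simp only [betaValue, mul_assoc, tsum_mul_left]
  exact mul_left_comm _ _ _

lemma betaValue_add (hβ : 1 < β) (hf : LinearGrowthWith C f) (hg : LinearGrowthWith D g) :
    betaValue β (fun n => f n + g n) = betaValue β f + betaValue β g := by
  simp only [betaValue, add_mul, (hf.summable hβ).tsum_add (hg.summable hβ), mul_add]

lemma betaValue_mono (hβ : 1 < β) (hf : LinearGrowthWith C f) (hg : LinearGrowthWith D g)
    (h : ∀ n, f n ≤ g n) : betaValue β f ≤ betaValue β g := by
  have hc : 0 ≤ 1 - β⁻¹ := sub_nonneg.2 (inv_le_one_of_one_le₀ hβ.le)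
  refine mul_le_mul_of_nonneg_left ?_ hc
  exact (hf.summable hβ).tsum_le_tsum (fun n => mul_le_mul_of_nonneg_right (h n) (by positivity))
    (hg.summable hβ)

lemma betaValue_lt (hβ : 1 < β) (hf : LinearGrowthWith C f) (hg : LinearGrowthWith D g)
    (h : ∀ n, f n ≤ g n) {n : ℕ} (hn : f n < g n) : betaValue β f < betaValue β g := by
  have hc : 0 < 1 - β⁻¹ := sub_pos.2 (inv_lt_one_of_one_lt₀ hβ)
  refine mul_lt_mul_of_pos_left ?_ hc
  exact (hf.summable hβ).tsum_lt_tsum (fun n => mul_le_mul_of_nonneg_right (h n) (by positivity))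
    (mul_lt_mul_of_pos_right hn (by positivity)) (hg.summable hβ)

lemma tendsto_betaValue {ι : Type*} {l : Filter ι} (hβ : 1 < β) {F : ι → ℕ → ℝ}
    (hF : ∀ᶠ i in l, LinearGrowthWith C (F i)) (h : ∀ n, Tendsto (F · n) l (𝓝 (f n))) :
    Tendsto (fun i => betaValue β (F i)) l (𝓝 (betaValue β f)) := by
  have hc0 : 0 < β⁻¹ := by positivity
  refine (tendsto_tsum_of_dominated_convergence ((linearGrowthWith_mul_add_one C).summable hβ)
    (fun n => (h n).mul_const _) ?_).const_mul _
  filter_upwards [hF] with i hi n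
  rw [Real.norm_eq_abs, abs_mul, abs_of_pos (pow_pos hc0 n)]
  exact mul_le_mul_of_nonneg_right (hi n) (pow_pos hc0 n).le

lemma betaValue_const (hβ : 1 < β) (c : ℝ) : betaValue β (fun _ => c) = c := by
  have hc : β⁻¹ < 1 := inv_lt_one_of_one_lt₀ hβ
  rw [betaValue, tsum_mul_left, tsum_geometric_of_lt_one (by positivity) hc, mul_left_comm,
    mul_inv_cancel₀ (sub_pos.2 hc).ne', mul_one]

lemma betaValue_eq_sum_add (hβ : 1 < β) (hf : LinearGrowthWith C f) (m : ℕ) :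
    betaValue β f = (1 - β⁻¹) * ∑ n ∈ Finset.range m, f n * β⁻¹ ^ n
      + β⁻¹ ^ m * betaValue β (fun n => f (n + m)) := by
  rw [betaValue, ← (hf.summable hβ).sum_add_tsum_nat_add m, betaValue, mul_left_comm (β⁻¹ ^ m),
    ← mul_add, ← tsum_mul_left]
  simp only [pow_add, mul_left_comm, mul_comm]

lemma betaValue_not_dvd (hβ : 1 < β) {q : ℕ} (hq : 0 < q) :
    betaValue β (fun n => if ¬ q ∣ n then 1 else 0) = (β ^ (q - 1) - 1) / (β ^ q - 1) := by
  have hβ0 : β ≠ 0 := by positivity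
  have hq1 : 0 < β ^ q - 1 := sub_pos.2 (one_lt_pow₀ hβ hq.ne')
  have hsum : ∑ n ∈ Finset.range q, (if ¬ q ∣ n then 1 else 0) * β⁻¹ ^ n
      = ∑ n ∈ Finset.range q, β⁻¹ ^ n - 1 := by
    obtain ⟨m, rfl⟩ := Nat.exists_eq_succ_of_ne_zero hq.ne'
    rw [Finset.sum_range_succ', Finset.sum_range_succ']
    simp only [dvd_zero, not_true_eq_false, if_false, zero_mul, add_zero, pow_zero,
      add_sub_cancel_right]
    refine Finset.sum_congr rfl fun n hn => ?_
    rw [if_pos (Nat.not_dvd_of_pos_of_lt n.succ_pos (by simpa using hn)), one_mul]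
  have hrec := betaValue_eq_sum_add hβ (linearGrowthWith_indicator fun n => ¬ q ∣ n) q
  simp only [Nat.dvd_add_self_right] at hrec
  rw [hsum, mul_sub, mul_neg_geom_sum, inv_pow] at hrec
  rw [eq_div_iff hq1.ne', pow_sub₀ _ hβ0 hq, pow_one]
  field_simp at hrec ⊢
  linarith

lemma betaValue_ne_zero (hβ : 1 < β) : betaValue β (fun n => if n ≠ 0 then 1 else 0) = β⁻¹ := by
  rw [betaValue_eq_sum_add hβ (linearGrowthWith_indicator _) 1]
  simp [betaValue_const hβ]

lemma betaValue_factorSum {w : ℕ → ℤ} (hβ : 1 < β) (hw : ∀ n, |(w n : ℝ)| ≤ C) (i : ℕ) :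
    β * betaValue β (fun n => factorSum w i n)
      = w i + betaValue β (fun n => factorSum w (i + 1) n) := by
  have hβ0 : β ≠ 0 := by positivity
  have hsplit (n : ℕ) : (factorSum w i (n + 1) : ℝ) = w i + factorSum w (i + 1) n := by
    rw [add_comm n, factorSum_add, factorSum_one]
    push_cast
    rfl
  rw [betaValue_eq_sum_add hβ (linearGrowthWith_factorSum hw i) 1]
  simp only [Finset.sum_range_one, factorSum_zero, Int.cast_zero, zero_mul, mul_zero, zero_add,
    pow_one, hsplit]
  rw [mul_inv_cancel_left₀ hβ0, betaValue_add hβ (linearGrowthWith_const (hw i))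
    (linearGrowthWith_factorSum hw (i + 1)), betaValue_const hβ]

lemma isBetaOrbit_betaValue (hβ : 1 < β) {w : ℕ → ℤ} (hw : ∀ n, |(w n : ℝ)| ≤ C) :
    IsBetaOrbit β (fun i => betaValue β fun n => factorSum w i n) w where
  bounded := by
    refine ⟨betaValue β fun n => C * (n + 1), fun i => abs_le.2 ⟨?_, ?_⟩⟩
    · rw [← betaValue_neg]
      refine betaValue_mono hβ (C := |C|) (fun n => ?_) (linearGrowthWith_factorSum hw i)
        fun n => (abs_le.1 (linearGrowthWith_factorSum hw i n)).1
      rw [abs_neg]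
      exact linearGrowthWith_mul_add_one C n
    · exact betaValue_mono hβ (linearGrowthWith_factorSum hw i) (linearGrowthWith_mul_add_one C)
        fun n => (abs_le.1 (linearGrowthWith_factorSum hw i n)).2
  step := betaValue_factorSum hβ hw

lemma IsBetaOrbit.eq_betaValue {x : ℕ → ℝ} {w : ℕ → ℤ} (h : IsBetaOrbit β x w) (hβ : 1 < β)
    (i : ℕ) : x i = betaValue β fun n => factorSum w i n := by
  obtain ⟨C, hC⟩ := h.exists_abs_digit_le
  exact congrFun (h.unique (isBetaOrbit_betaValue hβ hC) hβ) i

end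

/-! ### Extreme values -/

/-- The supremum of the orbits whose digits form a mechanical word of slope `α`. -/
noncomputable def upperValue (β α : ℝ) : ℝ := betaValue β fun n => ⌈α * n⌉

/-- The infimum of the orbits whose digits form a mechanical word of slope `α`. -/
noncomputable def lowerValue (β α : ℝ) : ℝ := betaValue β fun n => ⌊α * n⌋

section

variable {β α : ℝ}

lemma upperValue_neg (β α : ℝ) : upperValue β (-α) = -lowerValue β α := by
  simp only [upperValue, lowerValue, neg_mul, Int.ceil_neg, Int.cast_neg, betaValue_neg]

lemma upperValue_zero (β : ℝ) : upperValue β 0 = 0 := by simp [upperValue, betaValue]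

namespace IsBetaOrbit

variable {x : ℕ → ℝ} {w : ℕ → ℤ}

lemma upperValue_le (h : IsBetaOrbit β x w) (hβ : 1 < β)
    (hd : BddAbove (Set.range (discrepancy w α))) {C : ℝ} (hC : ∀ i, x i ≤ C) :
    upperValue β α ≤ C := by
  obtain ⟨D, hD⟩ := h.exists_abs_digit_le
  obtain ⟨u, hu⟩ := exists_seq_ceil_le_factorSum hd
  have hmin (k : ℕ) := (linearGrowthWith_ceil le_rfl).min (D := D) (f := fun n => ⌈α * n⌉)
    (linearGrowthWith_factorSum hD (u k))
  have hlim : Tendsto (fun k => betaValue β fun n => min (⌈α * n⌉ : ℝ) (factorSum w (u k) n)) atTop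
      (𝓝 (upperValue β α)) := by
    refine tendsto_betaValue hβ (.of_forall hmin) fun n => tendsto_const_nhds.congr' ?_
    filter_upwards [hu n] with k hk
    exact (min_eq_left (mod_cast hk)).symm
  refine le_of_tendsto' hlim fun k => ?_
  calc betaValue β (fun n => min (⌈α * n⌉ : ℝ) (factorSum w (u k) n))
      ≤ betaValue β (fun n => factorSum w (u k) n) :=
        betaValue_mono hβ (hmin k) (linearGrowthWith_factorSum hD (u k)) fun n =>
          min_le_right _ _
    _ = x (u k) := (h.eq_betaValue hβ (u k)).symm
    _ ≤ C := hC (u k)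

lemma le_lowerValue (h : IsBetaOrbit β x w) (hβ : 1 < β)
    (hd : BddBelow (Set.range (discrepancy w α))) {C : ℝ} (hC : ∀ i, C ≤ x i) :
    C ≤ lowerValue β α := by
  have hd' : BddAbove (Set.range (discrepancy (-w) (-α))) := by
    obtain ⟨b, hb⟩ := hd
    refine ⟨-b, ?_⟩
    rintro _ ⟨n, rfl⟩
    rw [discrepancy_neg]
    exact neg_le_neg (hb ⟨n, rfl⟩)
  have := h.neg.upperValue_le hβ hd' (C := -C) fun i => neg_le_neg (hC i)
  rw [upperValue_neg] at this
  linarith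

lemma isLUB_upperValue (h : IsBetaOrbit β x w) (hβ : 1 < β)
    (hd : ∀ i j, discrepancy w α i - discrepancy w α j < 1) :
    IsLUB (Set.range x) (upperValue β α) := by
  obtain ⟨D, hD⟩ := h.exists_abs_digit_le
  refine ⟨?_, fun C hC => h.upperValue_le hβ ⟨discrepancy w α 0 + 1, ?_⟩ fun i => hC ⟨i, rfl⟩⟩
  · rintro _ ⟨i, rfl⟩
    rw [h.eq_betaValue hβ]
    exact betaValue_mono hβ (linearGrowthWith_factorSum hD i) (linearGrowthWith_ceil le_rfl)
      fun n => mod_cast factorSum_le_ceil hd i n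
  · rintro _ ⟨i, rfl⟩
    linarith [hd i 0]

lemma isGLB_lowerValue (h : IsBetaOrbit β x w) (hβ : 1 < β)
    (hd : ∀ i j, discrepancy w α i - discrepancy w α j < 1) :
    IsGLB (Set.range x) (lowerValue β α) := by
  have h1 := h.neg.isLUB_upperValue hβ (α := -α) fun i j => by
    simp only [discrepancy_neg]
    linarith [hd j i]
  rw [upperValue_neg] at h1
  refine ⟨?_, fun C hC => ?_⟩
  · rintro _ ⟨i, rfl⟩
    exact neg_le_neg_iff.1 (h1.1 ⟨i, rfl⟩)
  · refine neg_le_neg_iff.1 (h1.2 ?_)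
    rintro _ ⟨i, rfl⟩
    exact neg_le_neg (hC ⟨i, rfl⟩)

end IsBetaOrbit

lemma upperValue_eq_lowerValue_add (hβ : 1 < β) (p : ℕ → Prop) [DecidablePred p]
    (h : ∀ n : ℕ, (⌈α * n⌉ : ℝ) = ⌊α * n⌋ + if p n then 1 else 0) :
    upperValue β α = lowerValue β α + betaValue β (fun n => if p n then 1 else 0) := by
  rw [upperValue, lowerValue, ← betaValue_add hβ (linearGrowthWith_floor le_rfl)
    (linearGrowthWith_indicator p)]
  simp only [h]

lemma ceil_eq_floor_add_ite {t : ℝ} {p : Prop} [Decidable p]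
    (h : p ↔ t ∉ Set.range ((↑) : ℤ → ℝ)) : (⌈t⌉ : ℝ) = ⌊t⌋ + if p then 1 else 0 := by
  split_ifs with hp
  · exact mod_cast Int.ceil_eq_floor_add_one_iff_notMem t |>.2 (h.1 hp)
  · obtain ⟨z, rfl⟩ := not_not.1 (mt h.2 hp)
    simp

lemma upperValue_of_irrational (hβ : 1 < β) (hα : Irrational α) :
    upperValue β α = lowerValue β α + β⁻¹ := by
  rw [upperValue_eq_lowerValue_add hβ (fun n => n ≠ 0) fun n => ceil_eq_floor_add_ite ?_,
    betaValue_ne_zero hβ]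
  refine ⟨fun hn => ?_, ?_⟩
  · rintro ⟨z, hz⟩
    exact (hα.mul_natCast hn).ne_int z hz.symm
  · rintro h rfl
    exact h ⟨0, by simp⟩

lemma den_dvd_iff (r : ℚ) (n : ℕ) : r.den ∣ n ↔ (r * n : ℝ) ∈ Set.range ((↑) : ℤ → ℝ) := by
  have hr : (r : ℝ) * r.den = r.num := mod_cast r.mul_den_eq_num
  constructor
  · rintro ⟨k, rfl⟩
    exact ⟨r.num * k, by push_cast; rw [← hr]; ring⟩
  · rintro ⟨z, hz⟩
    have hmul : (z * r.den : ℝ) = r.num * n := by rw [hz, ← hr]; ring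
    have hdvd : (r.den : ℤ) ∣ r.num * n := ⟨z, by rw [mul_comm _ z]; exact mod_cast hmul.symm⟩
    have hcop : IsCoprime (r.den : ℤ) r.num := by
      rw [Int.isCoprime_iff_nat_coprime]
      exact r.reduced.symm
    exact mod_cast hcop.dvd_of_dvd_mul_left hdvd

lemma upperValue_ratCast (hβ : 1 < β) (r : ℚ) :
    upperValue β r = lowerValue β r + (β ^ (r.den - 1) - 1) / (β ^ r.den - 1) := by
  rw [upperValue_eq_lowerValue_add hβ (fun n => ¬ r.den ∣ n) fun n =>
    ceil_eq_floor_add_ite (not_congr (den_dvd_iff r n)), betaValue_not_dvd hβ r.den_pos]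

lemma strictMono_upperValue (hβ : 1 < β) : StrictMono (upperValue β) := by
  intro α α' hlt
  obtain ⟨n, hn⟩ := exists_nat_gt (1 / (α' - α))
  rw [div_lt_iff₀ (sub_pos.2 hlt)] at hn
  refine betaValue_lt hβ (linearGrowthWith_ceil le_rfl) (linearGrowthWith_ceil le_rfl)
    (fun n => mod_cast Int.ceil_mono (mul_le_mul_of_nonneg_right hlt.le n.cast_nonneg)) (n := n) ?_
  linarith [Int.ceil_lt_add_one (α * n), Int.le_ceil (α' * n)]

lemma eventually_linearGrowthWith_ceil (α : ℝ) :
    ∀ᶠ α' : ℝ in 𝓝 α, LinearGrowthWith (|α| + 1 + 1) fun n => ⌈α' * n⌉ := by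
  filter_upwards [(continuous_abs.tendsto α).eventually_lt_const (lt_add_one |α|)] with α' h
  exact linearGrowthWith_ceil h.le

lemma tendsto_upperValue_nhdsLE (hβ : 1 < β) (α : ℝ) :
    Tendsto (upperValue β) (𝓝[≤] α) (𝓝 (upperValue β α)) := by
  refine tendsto_betaValue hβ
    ((eventually_linearGrowthWith_ceil α).filter_mono nhdsWithin_le_nhds) fun n => ?_
  have hcont : Tendsto (fun α' : ℝ => α' * n) (𝓝[≤] α) (𝓝[≤] (α * n)) :=
    ((continuous_mul_const (n : ℝ)).continuousWithinAt (s := Set.Iic α)).tendsto_nhdsWithin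
      fun _ h => Set.mem_Iic.2 (mul_le_mul_of_nonneg_right h n.cast_nonneg)
  refine tendsto_const_nhds.congr' ?_
  filter_upwards [tendsto_pure.1 ((tendsto_ceil_left_pure_ceil (α * n)).comp hcont)] with α' h
  exact congrArg _ h.symm

lemma tendsto_upperValue_nhdsGT (hβ : 1 < β) (α : ℝ) :
    Tendsto (upperValue β) (𝓝[>] α) (𝓝 (lowerValue β α + β⁻¹)) := by
  rw [lowerValue, ← betaValue_ne_zero hβ, ← betaValue_add hβ (linearGrowthWith_floor le_rfl)
    (linearGrowthWith_indicator _)]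
  refine tendsto_betaValue hβ
    ((eventually_linearGrowthWith_ceil α).filter_mono nhdsWithin_le_nhds) fun n => ?_
  rcases eq_or_ne n 0 with rfl | hn
  · simp
  have hcont : Tendsto (fun α' : ℝ => α' * n) (𝓝[>] α) (𝓝[>] (α * n)) :=
    ((continuous_mul_const (n : ℝ)).continuousWithinAt (s := Set.Ioi α)).tendsto_nhdsWithin
      fun _ h => Set.mem_Ioi.2 (mul_lt_mul_of_pos_right h (by positivity))
  refine tendsto_const_nhds.congr' ?_
  filter_upwards [tendsto_pure.1 ((tendsto_ceil_right_pure_floor_add_one (α * n)).comp hcont)]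
    with α' h
  rw [Function.comp_apply] at h
  rw [h, if_pos hn]
  push_cast
  rfl

lemma lowerValue_add_inv_lt_upperValue (hβ : 1 < β) {α' : ℝ} (h : α < α') :
    lowerValue β α + β⁻¹ < upperValue β α' := by
  obtain ⟨γ, hαγ, hγα'⟩ := exists_between h
  refine lt_of_le_of_lt ?_ (strictMono_upperValue hβ hγα')
  refine le_of_tendsto (tendsto_upperValue_nhdsGT hβ α) ?_
  filter_upwards [Ioo_mem_nhdsGT hαγ] with δ hδ
  exact (strictMono_upperValue hβ hδ.2).le

lemma mul_inv_le_upperValue (hβ : 1 < β) (hα : 0 ≤ α) : α * β⁻¹ ≤ upperValue β α := by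
  rw [← betaValue_ne_zero hβ, ← betaValue_const_mul]
  refine betaValue_mono hβ ((linearGrowthWith_indicator _).const_mul α)
    (linearGrowthWith_ceil le_rfl) fun n => (le_trans ?_ (Int.le_ceil (α * n)))
  refine mul_le_mul_of_nonneg_left ?_ hα
  split_ifs with hn
  · exact mod_cast Nat.one_le_iff_ne_zero.2 hn
  · exact n.cast_nonneg

lemma exists_upperValue_le_one_and_le_lowerValue (hβ : 1 < β) :
    ∃ α, upperValue β α ≤ 1 ∧ 1 - β⁻¹ ≤ lowerValue β α := by
  have hbdd : BddAbove {α | upperValue β α ≤ 1} := ⟨β, fun α hα => by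
    rcases le_total α 0 with h | h
    · linarith
    · have := (mul_inv_le_upperValue hβ h).trans hα
      rwa [mul_inv_le_iff₀ (by linarith), one_mul] at this⟩
  have hne : {α | upperValue β α ≤ 1}.Nonempty := ⟨0, by simp [upperValue_zero]⟩
  refine ⟨sSup {α | upperValue β α ≤ 1}, ?_, ?_⟩
  · refine le_of_tendsto ((tendsto_upperValue_nhdsLE hβ _).mono_left
      (nhdsWithin_mono _ Set.Iio_subset_Iic_self)) ?_
    filter_upwards [self_mem_nhdsWithin] with α hα
    obtain ⟨α', hα', hlt⟩ := exists_lt_of_lt_csSup hne hα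
    exact (strictMono_upperValue hβ hlt).le.trans hα'
  · rw [sub_le_iff_le_add]
    refine ge_of_tendsto (tendsto_upperValue_nhdsGT hβ _) ?_
    filter_upwards [self_mem_nhdsWithin] with α hα
    exact (lt_of_not_ge fun h => notMem_of_csSup_lt hα hbdd h).le

lemma le_of_upperValue_le_one (hβ : 1 < β) {α' : ℝ} (hα : 1 - β⁻¹ ≤ lowerValue β α)
    (hα' : upperValue β α' ≤ 1) : α' ≤ α := by
  by_contra! h
  linarith [lowerValue_add_inv_lt_upperValue hβ h]

end

/-! ### Orbits of the beta-transformation -/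

lemma upperFract_eq_sub_ceil (t : ℝ) : upperFract t = t - (⌈t⌉ - 1) := by
  unfold upperFract
  split_ifs with h
  · obtain ⟨z, rfl⟩ := Int.fract_eq_zero_iff.1 h
    simp
  · rw [Int.ceil_eq_add_one_sub_fract h]
    ring

lemma upperFract_mem_Ioc (t : ℝ) : upperFract t ∈ Set.Ioc 0 1 := by
  rw [upperFract_eq_sub_ceil]
  exact ⟨by linarith [Int.ceil_lt_add_one t], by linarith [Int.le_ceil t]⟩

lemma continuousWithinAt_upperFract {s : Set ℝ} {δ : ℝ} (hδ : 0 < δ)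
    (hs : ∀ z ∈ s, δ ≤ upperFract z) (t : ℝ) : ContinuousWithinAt upperFract s t := by
  have hIoo : Set.Ioo (⌈t⌉ - 1 : ℝ) (⌈t⌉ + δ) ∈ 𝓝 t :=
    Ioo_mem_nhds (by linarith [Int.ceil_lt_add_one t]) (by linarith [Int.le_ceil t])
  have heq : upperFract =ᶠ[𝓝[s] t] fun z => z - (⌈t⌉ - 1) := by
    filter_upwards [self_mem_nhdsWithin, mem_nhdsWithin_of_mem_nhds hIoo] with z hz hzt
    have hzδ := hs z hz
    rw [upperFract_eq_sub_ceil] at hzδ ⊢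
    have hlt : ⌈z⌉ < ⌈t⌉ + 1 := by rify; linarith [hzt.2]
    have hgt : ⌈t⌉ - 1 < ⌈z⌉ := by rify; linarith [hzt.1, Int.le_ceil z]
    rw [show ⌈z⌉ = ⌈t⌉ by omega]
  exact (continuous_id.sub continuous_const).continuousWithinAt.congr_of_eventuallyEq heq
    (upperFract_eq_sub_ceil t)

lemma continuousWithinAt_betaMap {β δ : ℝ} {s : Set ℝ} (hδ : 0 < δ) (hs : ∀ z ∈ s, δ ≤ betaMap β z)
    (y : ℝ) : ContinuousWithinAt (betaMap β) s y :=
  (continuousWithinAt_upperFract hδ (Set.forall_mem_image.2 hs) (β * y)).comp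
    (continuous_const_mul β).continuousWithinAt (Set.mapsTo_image _ s)

section

variable {β : ℝ}

lemma iterate_betaMap_mem_Ioc (ξ : ℝ) (n : ℕ) : (betaMap β)^[n + 1] ξ ∈ Set.Ioc 0 1 := by
  rw [Function.iterate_succ_apply']
  exact upperFract_mem_Ioc _

lemma isBetaOrbit_iterate_betaMap (β ξ : ℝ) :
    IsBetaOrbit β (fun n => (betaMap β)^[n] ξ) (betaExpansion β ξ) where
  bounded := by
    refine ⟨max |ξ| 1, fun n => ?_⟩
    rcases n with _ | n
    · exact le_max_left _ _
    · obtain ⟨h0, h1⟩ := iterate_betaMap_mem_Ioc (β := β) ξ n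
      exact (abs_of_pos h0).trans_le (h1.trans (le_max_right _ _))
  step n := by
    rw [Function.iterate_succ_apply', betaMap, upperFract_eq_sub_ceil, betaExpansion]
    push_cast
    ring

lemma betaExpansion_iterate (β ξ : ℝ) (k : ℕ) :
    betaExpansion β ((betaMap β)^[k] ξ) = shiftWord k (betaExpansion β ξ) := by
  funext n
  rw [shiftWord, betaExpansion, betaExpansion, ← Function.iterate_add_apply, add_comm]

lemma shiftWord_one_betaExpansion_nonneg (hβ : 0 < β) (ξ : ℝ) (n : ℕ) :
    0 ≤ shiftWord 1 (betaExpansion β ξ) n := by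
  rw [shiftWord, betaExpansion, sub_nonneg, Int.one_le_ceil_iff, add_comm]
  exact mul_pos hβ (iterate_betaMap_mem_Ioc ξ n).1

namespace IsBetaOrbit

variable {x : ℕ → ℝ} {w : ℕ → ℤ}

lemma ceil_mul (h : IsBetaOrbit β x w) (hx : ∀ n, x n ∈ Set.Ioc 0 1) (n : ℕ) :
    ⌈β * x n⌉ = w n + 1 := by
  obtain ⟨h0, h1⟩ := hx (n + 1)
  rw [Int.ceil_eq_iff, h.step n]
  push_cast
  exact ⟨by linarith, by linarith⟩

lemma betaMap_apply (h : IsBetaOrbit β x w) (hx : ∀ n, x n ∈ Set.Ioc 0 1) (n : ℕ) :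
    betaMap β (x n) = x (n + 1) := by
  rw [betaMap, upperFract_eq_sub_ceil, h.ceil_mul hx, h.step n]
  push_cast
  ring

lemma iterate_betaMap (h : IsBetaOrbit β x w) (hx : ∀ n, x n ∈ Set.Ioc 0 1) (n : ℕ) :
    (betaMap β)^[n] (x 0) = x n := by
  induction n with
  | zero => rfl
  | succ n ih => rw [Function.iterate_succ_apply', ih, h.betaMap_apply hx]

end IsBetaOrbit

lemma abs_sub_le_inv {a b : ℝ} (ha : a ∈ Set.Icc (1 - β⁻¹) 1) (hb : b ∈ Set.Icc (1 - β⁻¹) 1) :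
    |a - b| ≤ β⁻¹ := by
  simpa using abs_sub_le_of_le_of_le ha.1 ha.2 hb.1 hb.2

/-! ### The top frequency -/

lemma hasFrequency_iff_hasSlope {y α : ℝ} :
    HasFrequency β y α ↔ HasSlope (betaExpansion β y) α := by
  simp [HasFrequency, HasSlope, factorSum]

lemma mapsTo_betaMap_closure {s : Set ℝ} {δ : ℝ} (hδ : 0 < δ) (hs : ∀ z ∈ s, δ ≤ z)
    (h : Set.MapsTo (betaMap β) s s) : Set.MapsTo (betaMap β) (closure s) (closure s) :=
  fun y hy => closure_mono h.image_subset
    ((continuousWithinAt_betaMap hδ (fun _ hz => hs _ (h hz)) y).mem_closure_image hy)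

lemma image_betaMap_closure {s : Set ℝ} {δ C : ℝ} (hδ : 0 < δ) (hs : s ⊆ Set.Icc δ C)
    (h : Set.MapsTo (betaMap β) s s) :
    betaMap β '' closure s = closure (betaMap β '' s) := by
  have hK : closure s ⊆ Set.Icc δ C := isClosed_Icc.closure_subset_iff.2 hs
  have hmaps := mapsTo_betaMap_closure hδ (fun z hz => (hs hz).1) h
  exact image_closure_of_isCompact (isCompact_Icc.of_isClosed_subset isClosed_closure hK)
    fun y _ => continuousWithinAt_betaMap hδ (fun _ hz => (hK (hmaps hz)).1) y

namespace IsTopFrequency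

variable {α : ℝ}

lemma exists_orbit (h : IsTopFrequency β α) :
    ∃ x w, IsBetaOrbit β x w ∧ (∀ n, x n ∈ Set.Icc (1 - β⁻¹) 1) ∧ HasSlope w α := by
  obtain ⟨x, -, hK, -, hfreq⟩ := h
  rw [one_div] at hK
  exact ⟨_, _, isBetaOrbit_iterate_betaMap β x, fun n => hK (subset_closure ⟨n, rfl⟩),
    hasFrequency_iff_hasSlope.1 (hfreq x (subset_closure ⟨0, rfl⟩))⟩

lemma upperValue_le_one (h : IsTopFrequency β α) (hβ : 1 < β) : upperValue β α ≤ 1 := by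
  obtain ⟨x, w, horbit, hx, hα⟩ := h.exists_orbit
  have hb := horbit.sumBalanced hβ fun i j => abs_sub_le_inv (hx i) (hx j)
  refine horbit.upperValue_le hβ ⟨1, Set.forall_mem_range.2 fun n => ?_⟩ fun n => (hx n).2
  simpa using hb.discrepancy_sub_le hα n 0

lemma le_lowerValue (h : IsTopFrequency β α) (hβ : 1 < β) : 1 - β⁻¹ ≤ lowerValue β α := by
  obtain ⟨x, w, horbit, hx, hα⟩ := h.exists_orbit
  have hb := horbit.sumBalanced hβ fun i j => abs_sub_le_inv (hx i) (hx j)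
  refine horbit.le_lowerValue hβ ⟨-1, Set.forall_mem_range.2 fun n => ?_⟩ fun n => (hx n).1
  simpa [neg_le] using hb.discrepancy_sub_le hα 0 n

end IsTopFrequency

lemma exists_isBetaOrbit_isMechanical (hβ : 1 < β) {α : ℝ} (hα : 0 ≤ α) :
    ∃ x w, IsBetaOrbit β x w ∧ IsMechanical w α ∧ x 0 = upperValue β α := by
  have hw : IsMechanical (upperMechanical α 0) α := ⟨hα, 0, by simp, .inr rfl⟩
  refine ⟨_, _, isBetaOrbit_betaValue hβ (C := ⌈α⌉) (w := upperMechanical α 0) fun n => ?_, hw, ?_⟩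
  · exact mod_cast hw.abs_le_ceil n
  · simp [factorSum_upperMechanical, upperValue]

namespace IsBetaOrbit

variable {x : ℕ → ℝ} {w : ℕ → ℤ} {α : ℝ}

lemma apply_zero_mem_closure (h : IsBetaOrbit β x w) (hβ : 1 < β) (hw : IsMechanical w α)
    (h0 : x 0 = upperValue β α) : x 0 ∈ closure (Set.range fun n => x (1 + n)) := by
  rw [h0]
  exact ((h.shift 1).isLUB_upperValue hβ (hw.shiftWord 1).discrepancy_sub_lt).mem_closure
    (Set.range_nonempty _)

lemma image_betaMap_closure_range (h : IsBetaOrbit β x w) (hβ : 1 < β) (hw : IsMechanical w α)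
    (h0 : x 0 = upperValue β α) (hx : Set.range x ⊆ Set.Icc (1 - β⁻¹) 1) :
    betaMap β '' closure (Set.range x) = closure (Set.range x) := by
  have hpos : 0 < 1 - β⁻¹ := sub_pos.2 (inv_lt_one_of_one_lt₀ hβ)
  have hIoc (n : ℕ) : x n ∈ Set.Ioc 0 1 := Set.Icc_subset_Ioc_left hpos (hx ⟨n, rfl⟩)
  have himage : betaMap β '' Set.range x = Set.range fun n => x (1 + n) := by
    rw [← Set.range_comp]
    congr 1
    funext n
    rw [Function.comp_apply, h.betaMap_apply hIoc, add_comm]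
  have hsub : Set.range (fun n => x (1 + n)) ⊆ Set.range x := Set.range_comp_subset_range _ x
  rw [image_betaMap_closure hpos hx (Set.mapsTo_iff_image_subset.2 (himage ▸ hsub)), himage]
  refine (closure_mono hsub).antisymm (closure_minimal ?_ isClosed_closure)
  rintro _ ⟨_ | n, rfl⟩
  · exact h.apply_zero_mem_closure hβ hw h0
  · exact subset_closure ⟨n, by rw [add_comm]⟩

lemma hasFrequency (h : IsBetaOrbit β x w) (hβ : 1 < β) (hw : IsMechanical w α)
    (hx : ∀ n, x n ∈ Set.Icc (1 - β⁻¹) 1) {y : ℝ}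
    (hy : ∀ n, (betaMap β)^[n] y ∈ Set.Icc (1 - β⁻¹) 1) : HasFrequency β y α := by
  refine hasFrequency_iff_hasSlope.2 (hasSlope_of_abs_discrepancy_le (C := 1 + 1) fun n => ?_)
  have hd : |discrepancy w α n| ≤ 1 := by
    rw [abs_le, neg_le]
    exact ⟨by simpa using (hw.discrepancy_sub_lt 0 n).le,
      by simpa using (hw.discrepancy_sub_lt n 0).le⟩
  have hF : |(factorSum (betaExpansion β y - w) 0 n : ℝ)| ≤ 1 :=
    mod_cast ((isBetaOrbit_iterate_betaMap β y).sub h).abs_factorSum_le_one hβ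
      (fun n => abs_sub_le_inv (hy n) (hx n)) n
  have hsub : discrepancy (betaExpansion β y) α n
      = discrepancy w α n - factorSum (betaExpansion β y - w) 0 n := by
    simp [discrepancy, factorSum]
  rw [hsub]
  exact (abs_sub _ _).trans (add_le_add hd hF)

end IsBetaOrbit

lemma isTopFrequency_of_bounds (hβ : 1 < β) {α : ℝ} (hU : upperValue β α ≤ 1)
    (hL : 1 - β⁻¹ ≤ lowerValue β α) : IsTopFrequency β α := by
  have hpos : 0 < 1 - β⁻¹ := sub_pos.2 (inv_lt_one_of_one_lt₀ hβ)
  have hα : 0 ≤ α := by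
    by_contra! hneg
    linarith [lowerValue_add_inv_lt_upperValue hβ hneg, upperValue_zero β]
  obtain ⟨x, w, h, hw, h0⟩ := exists_isBetaOrbit_isMechanical hβ hα
  have hd := hw.discrepancy_sub_lt
  have hx : Set.range x ⊆ Set.Icc (1 - β⁻¹) 1 := fun y hy =>
    ⟨hL.trans ((h.isGLB_lowerValue hβ hd).1 hy), ((h.isLUB_upperValue hβ hd).1 hy).trans hU⟩
  have hIoc (n : ℕ) : x n ∈ Set.Ioc 0 1 := Set.Icc_subset_Ioc_left hpos (hx ⟨n, rfl⟩)
  have horbit : betaOrbit β (x 0) = Set.range x :=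
    congrArg Set.range (funext (h.iterate_betaMap hIoc))
  have hK : closure (Set.range x) ⊆ Set.Icc (1 - β⁻¹) 1 := isClosed_Icc.closure_subset_iff.2 hx
  have himage := h.image_betaMap_closure_range hβ hw h0 hx
  refine ⟨x 0, Set.Ioc_subset_Icc_self (hIoc 0), ?_⟩
  rw [horbit, one_div]
  exact ⟨hK, himage, fun y hy => h.hasFrequency hβ hw (fun n => hx ⟨n, rfl⟩) fun n =>
    hK ((Set.mapsTo_iff_image_subset.2 himage.subset).iterate n hy)⟩

lemma isTopFrequency_iff (hβ : 1 < β) {α : ℝ} :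
    IsTopFrequency β α ↔ upperValue β α ≤ 1 ∧ 1 - β⁻¹ ≤ lowerValue β α :=
  ⟨fun h => ⟨h.upperValue_le_one hβ, h.le_lowerValue hβ⟩,
    fun h => isTopFrequency_of_bounds hβ h.1 h.2⟩

lemma existsUnique_isTopFrequency (hβ : 1 < β) : ∃! α, IsTopFrequency β α := by
  simp only [isTopFrequency_iff hβ]
  obtain ⟨α, hU, hL⟩ := exists_upperValue_le_one_and_le_lowerValue hβ
  exact ⟨α, ⟨hU, hL⟩, fun α' h => (le_of_upperValue_le_one hβ hL h.1).antisymm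
    (le_of_upperValue_le_one hβ h.2 hU)⟩

lemma le_Freq (hβ : 1 < β) {α : ℝ} (hα : upperValue β α ≤ 1) : α ≤ Freq β :=
  le_of_upperValue_le_one hβ ((isTopFrequency_iff hβ).1
    (Classical.epsilon_spec (existsUnique_isTopFrequency hβ).exists)).2 hα

/-! ### Words of orbits of small diameter -/

lemma abs_sub_le_betaDiam (β ξ : ℝ) (i j : ℕ) :
    |(betaMap β)^[i] ξ - (betaMap β)^[j] ξ| ≤ betaDiam β ξ := by
  obtain ⟨M, hM⟩ := (isBetaOrbit_iterate_betaMap β ξ).bounded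
  have hub : BddAbove (Set.range fun n => (betaMap β)^[n] ξ) :=
    ⟨M, Set.forall_mem_range.2 fun n => (abs_le.1 (hM n)).2⟩
  have hlb : BddBelow (Set.range fun n => (betaMap β)^[n] ξ) :=
    ⟨-M, Set.forall_mem_range.2 fun n => (abs_le.1 (hM n)).1⟩
  exact abs_sub_le_of_le_of_le (ciInf_le hlb i) (le_ciSup hub i) (ciInf_le hlb j) (le_ciSup hub j)

lemma betaDiam_of_isMechanical (hβ : 1 < β) {ξ α : ℝ} (h : IsMechanical (betaExpansion β ξ) α) :
    betaDiam β ξ = upperValue β α - lowerValue β α := by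
  have horbit := isBetaOrbit_iterate_betaMap β ξ
  rw [betaDiam, (horbit.isLUB_upperValue hβ h.discrepancy_sub_lt).ciSup_eq,
    (horbit.isGLB_lowerValue hβ h.discrepancy_sub_lt).ciInf_eq]

lemma betaDiam_of_isMechanical_ratCast (hβ : 1 < β) {ξ : ℝ} {r : ℚ}
    (h : IsMechanical (betaExpansion β ξ) r) :
    betaDiam β ξ = (β ^ (r.den - 1) - 1) / (β ^ r.den - 1) := by
  rw [betaDiam_of_isMechanical hβ h, upperValue_ratCast hβ, add_sub_cancel_left]

lemma betaDiam_of_isSturmian (hβ : 1 < β) {ξ α : ℝ} (h : IsSturmian (betaExpansion β ξ) α) :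
    betaDiam β ξ = 1 / β := by
  rw [betaDiam_of_isMechanical hβ h.2, upperValue_of_irrational hβ h.1, add_sub_cancel_left,
    one_div]

lemma exists_betaDiam_iterate_of_isSkew (hβ : 1 < β) {ξ : ℝ} {r : ℚ}
    (h : IsSkew (betaExpansion β ξ) r) : ∃ K : ℕ, ∀ k, K ≤ k →
      betaDiam β ((betaMap β)^[k] ξ) = (β ^ (r.den - 1) - 1) / (β ^ r.den - 1) := by
  obtain ⟨-, -, m, -, hm⟩ := h
  refine ⟨m, fun k hk => betaDiam_of_isMechanical_ratCast hβ ?_⟩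
  obtain ⟨l, rfl⟩ := Nat.exists_eq_add_of_le hk
  rw [add_comm, Function.iterate_add_apply, betaExpansion_iterate, betaExpansion_iterate]
  exact hm.shiftWord l

lemma exists_hasSlope_betaExpansion (hβ : 1 < β) {ξ : ℝ}
    (hb : SumBalanced (betaExpansion β ξ)) :
    ∃ α, 0 ≤ α ∧ α ≤ Freq β ∧ HasSlope (betaExpansion β ξ) α := by
  obtain ⟨α, hd⟩ := hb.exists_discrepancy_sub_le
  have hd' (i j : ℕ) : discrepancy (shiftWord 1 (betaExpansion β ξ)) α i
      - discrepancy (shiftWord 1 (betaExpansion β ξ)) α j ≤ 1 := by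
    rw [discrepancy_shiftWord, discrepancy_shiftWord, sub_sub_sub_cancel_right]
    exact hd _ _
  refine ⟨α, (hasSlope_of_discrepancy_sub_le hd').nonneg
    (shiftWord_one_betaExpansion_nonneg (one_pos.trans hβ) ξ), le_Freq hβ ?_,
    hasSlope_of_discrepancy_sub_le hd⟩
  refine ((isBetaOrbit_iterate_betaMap β ξ).shift 1).upperValue_le hβ
    ⟨1, Set.forall_mem_range.2 fun n => ?_⟩ fun n => ?_
  · simpa using hd' n 0
  · rw [add_comm]
    exact (iterate_betaMap_mem_Ioc ξ n).2

lemma sturmianCase_or_mechanicalCase_or_skewCase (hβ : 1 < β) {ξ : ℝ}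
    (hdiam : betaDiam β ξ ≤ 1 / β) :
    SturmianCase β ξ ∨ MechanicalCase β ξ ∨ SkewCase β ξ := by
  have hb : SumBalanced (betaExpansion β ξ) :=
    (isBetaOrbit_iterate_betaMap β ξ).sumBalanced hβ fun i j =>
      (abs_sub_le_betaDiam β ξ i j).trans (hdiam.trans_eq (one_div β))
  obtain ⟨α, h0, hFreq, hslope⟩ := exists_hasSlope_betaExpansion hβ hb
  rcases hb.isMechanical_or_isSkew h0 hslope with hmech | ⟨r, rfl, hskew⟩
  · by_cases hα : Irrational α
    · exact .inl ⟨⟨α, hFreq, hα, hmech⟩, betaDiam_of_isSturmian hβ ⟨hα, hmech⟩⟩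
    · obtain ⟨r, rfl⟩ := not_not.1 hα
      exact .inr (.inl ⟨r, hFreq, hmech, betaDiam_of_isMechanical_ratCast hβ hmech⟩)
  · exact .inr (.inr ⟨r, hFreq, hskew, exists_betaDiam_iterate_of_isSkew hβ hskew⟩)

end

end Orbits

theorem theorem5_general (β ξ : ℝ) (hβ : 1 < β) (hdiam : betaDiam β ξ ≤ 1 / β) :
    (∃! α : ℝ, IsTopFrequency β α) ∧
    (SturmianCase β ξ ∨ MechanicalCase β ξ ∨ SkewCase β ξ) ∧
    ¬ (SturmianCase β ξ ∧ MechanicalCase β ξ) ∧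
    ¬ (SturmianCase β ξ ∧ SkewCase β ξ) ∧
    ¬ (MechanicalCase β ξ ∧ SkewCase β ξ) := by
  refine ⟨existsUnique_isTopFrequency hβ,
    sturmianCase_or_mechanicalCase_or_skewCase hβ hdiam, ?_, ?_, ?_⟩
  · rintro ⟨⟨⟨α, -, hsturmian⟩, -⟩, r, -, hmech, -⟩
    exact hsturmian.not_hasSlope_ratCast r hmech.hasSlope
  · rintro ⟨⟨⟨α, -, hsturmian⟩, -⟩, r, -, hskew, -⟩
    exact hsturmian.not_hasSlope_ratCast r hskew.hasSlope
  · rintro ⟨⟨r, -, hmech, -⟩, s, -, hskew, -⟩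
    exact hmech.not_isSkew hskew

theorem theorem5 (β ξ : ℝ) (hβ : 1 < β) (hξ : ξ ∈ Set.Icc (0 : ℝ) 1)
    (hdiam : betaDiam β ξ ≤ 1 / β) :
    (∃! α : ℝ, IsTopFrequency β α) ∧
    (SturmianCase β ξ ∨ MechanicalCase β ξ ∨ SkewCase β ξ) ∧
    ¬ (SturmianCase β ξ ∧ MechanicalCase β ξ) ∧
    ¬ (SturmianCase β ξ ∧ SkewCase β ξ) ∧
    ¬ (MechanicalCase β ξ ∧ SkewCase β ξ) :=
  theorem5_general β ξ hβ hdiam
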